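/- Let $u\in C^3(\mathbb R^2)$ be real-valued with $\inf_{\mathbb R^2}|\nabla u|>0$. Then there exists $\Phi\in C^1(\mathbb R^2;\mathbb R^2)$ whose Jacobian matrix $\nabla\Phi(x)=(\partial\Phi_i/\partial x_j(x))_{i,j}$ is invertible at every $x\in\mathbb R^2$ and such that $$\nabla\Phi\,\nabla u=e_1=\begin{pmatrix}1\\0\end{pmatrix}\quad\text{in }\mathbb R^2 .$$ Consequently $\nabla u$ is globally rectified: for every solution $X$ of $X'=\nabla u(X)$, the curve $Y=\Phi(X)$ solves $Y'=e_1$. Moreover $\Phi$ can be taken of the form $\Phi=(-\tau,v)$, where, denoting by $X(\cdot,x)$ the maximal solution of $\partial_tX(t,x)=\nabla u(X(t,x))$, $X(0,x)=x$: - $\tau\in C^1(\mathbb R^2)$, and for each $x\in\mathbb R^2$, $\tau(x)$ is the unique time $t$ (of either sign) in the interval of existence of $X(\cdot,x)$ for which $u(X(t,x))=0$; - the function $\sigma(x)=\exp\Big(\int_0^{\tau(x)}\Delta u(X(s,x))\,ds\Big)>0$ belongs to $C^1(\mathbb R^2)$ and satisfies $\mathrm{div}(\sigma\nabla u)=0$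 in $\mathbb R^2$; - $v\in C^1(\mathbb R^2)$ is a stream function of $\sigma\nabla u$, that is $\sigma\nabla u=\nabla^\perp v:=(-\partial_{x_2}v,\partial_{x_1}v)$ in $\mathbb R^2$. -/

import Mathlib

/-- The Euclidean plane. -/
abbrev Plane : Type := EuclideanSpace ℝ (Fin 2)

namespace Plane

/-- The standard basis vector `e i`; thus `e 0` is the vector with coordinates `(1, 0)`. -/
noncomputable def e (i : Fin 2) : Plane := EuclideanSpace.single i (1 : ℝ)

/-- The Jacobian matrix of `Φ` at `x`: entry `(i, j)` is `∂Φᵢ/∂xⱼ (x)`. -/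
noncomputable def jacobian (Φ : Plane → Plane) (x : Plane) : Matrix (Fin 2) (Fin 2) ℝ :=
  Matrix.of fun i j => fderiv ℝ Φ x (e j) i

/-- The divergence `∂F₁/∂x₁ + ∂F₂/∂x₂` of a planar vector field. -/
noncomputable def divergence (F : Plane → Plane) (x : Plane) : ℝ :=
  ∑ i, fderiv ℝ (fun y => F y i) x (e i)

/-- The rotated gradient `(-∂v/∂x₂, ∂v/∂x₁)`. -/
noncomputable def perpGradient (v : Plane → ℝ) (x : Plane) : Plane :=
  !₂[-(fderiv ℝ v x (e 1)), fderiv ℝ v x (e 0)]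

/-- `γ` solves `γ' = ∇u(γ)` on the compact time interval between `0` and `T` (of either sign),
with `γ 0 = x`. -/
def IsGradientTrajectory (u : Plane → ℝ) (x : Plane) (T : ℝ) (γ : ℝ → Plane) : Prop :=
  γ 0 = x ∧ IsIntegralCurveOn γ (fun _ y => gradient u y) (Set.uIcc 0 T)

/-- The gradient trajectory issued from `x` exists between the times `0` and `T`
and is on the equipotential `{u = 0}` at time `T`. -/
def ReachesZeroLevelAt (u : Plane → ℝ) (x : Plane) (T : ℝ) : Prop :=
  ∃ γ : ℝ → Plane, IsGradientTrajectory u x T γ ∧ u (γ T) = 0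

end Plane

/-! Divide the gradient by its squared length: along `F = ∇u/|∇u|²` the function `u` grows at unit
speed, and `F` is bounded because `|∇u|` is bounded below. So `F`-curves last as long as needed and
meet `{u = 0}` at time exactly `-u x`. Undoing the time change, the true crossing time is `τ x = ∫
|∇u|⁻²` along the `F`-curve from time `0` to `-u x`, and `ρ = log σ` is the same integral of `|∇u|⁻²
Δu`.

Both are `C¹`: rescaled to `[0, 1]`, the curve solves `γ = x + c ∫ F(γ)` with `c = -u x`, and the
implicit function theorem in `C(I, E)` applies because `1` minus a Volterra operator is invertible
(`exists_levelIntegral`).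

Moving the base point along its own curve gives `∇τ·∇u = -1` and `∇ρ·∇u = -Δu`. The latter says that
`e^ρ ∇u` is divergence free, hence has a stream function `v`. Then `∇v·∇u = 0`, so `(-τ, v)` sends
`∇u` to `e₁`; it is nondegenerate since `∇v` vanishes only on directions parallel to `∇u`, where
`∇τ` does not. -/

section

open Set Filter Topology unitInterval

/-! ### Superposition operators on spaces of continuous functions -/

section Nemytskii

variable {K E F : Type*} [TopologicalSpace K] [CompactSpace K]
  [NormedAddCommGroup E] [NormedSpace ℝ E] [NormedAddCommGroup F] [NormedSpace ℝ F]

/-- Pointwise application of a continuous family of operators to a continuous function. -/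
noncomputable def ContinuousMap.applyL :
    C(K, E →L[ℝ] F) →L[ℝ] C(K, E) →L[ℝ] C(K, F) :=
  LinearMap.mkContinuous₂
    (LinearMap.mk₂ ℝ (fun (A : C(K, E →L[ℝ] F)) (h : C(K, E)) =>
        (⟨fun t => A t (h t), A.continuous.clm_apply h.continuous⟩ : C(K, F)))
      (fun _ _ _ => by ext; simp) (fun _ _ _ => by ext; simp)
      (fun _ _ _ => by ext; simp) (fun _ _ _ => by ext; simp)) 1
    (fun A h => by
      rw [one_mul]
      refine (ContinuousMap.norm_le _ (by positivity)).2 fun t => ?_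
      exact (A t).le_of_opNorm_le_of_le (A.norm_coe_le_norm t) (h.norm_coe_le_norm t))

@[simp] theorem ContinuousMap.applyL_apply (A : C(K, E →L[ℝ] F)) (h : C(K, E)) (t : K) :
    ContinuousMap.applyL A h t = A t (h t) := rfl

/-- Composition with a `C¹` map is a `C¹` map between spaces of continuous functions. -/
theorem ContinuousMap.hasFDerivAt_postcomp {G : E → F} (hG : ContDiff ℝ 1 G) (γ : C(K, E)) :
    HasFDerivAt (fun γ : C(K, E) => (⟨G, hG.continuous⟩ : C(E, F)).comp γ)
      (ContinuousMap.applyL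
        ((⟨fderiv ℝ G, hG.continuous_fderiv one_ne_zero⟩ : C(E, E →L[ℝ] F)).comp γ)) γ := by
  set D : C(E, E →L[ℝ] F) := ⟨fderiv ℝ G, hG.continuous_fderiv one_ne_zero⟩ with hD
  have hcont : Continuous fun γ : C(K, E) => D.comp γ := D.continuous_postcomp
  rw [hasFDerivAt_iff_isLittleO, Asymptotics.isLittleO_iff]
  intro ε hε
  obtain ⟨δ, hδ, hball⟩ := Metric.continuousAt_iff (α := C(K, E)) (β := C(K, E →L[ℝ] F))
    |>.1 hcont.continuousAt ε hε
  filter_upwards [Metric.ball_mem_nhds γ hδ] with γ' hγ'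
  refine (ContinuousMap.norm_le _ (by positivity)).2 fun t => ?_
  -- The segment between `γ t` and `γ' t` is traced by `a • γ + b • γ'`, which stays in the `δ`-ball
  -- of `C(K, E)`; this makes the bound uniform in `t`.
  have key : ∀ z ∈ segment ℝ (γ t) (γ' t), ‖fderiv ℝ G z - fderiv ℝ G (γ t)‖ ≤ ε := by
    rintro z ⟨a, b, ha, hb, hab, rfl⟩
    have hmem : a • γ + b • γ' ∈ Metric.ball γ δ :=
      (convex_ball γ δ) (Metric.mem_ball_self hδ) hγ' ha hb hab
    have h1 := (hball hmem).le
    have h2 := (ContinuousMap.dist_apply_le_dist t).trans h1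
    simpa [dist_eq_norm, hD] using h2
  have h3 := (convex_segment (γ t) (γ' t)).norm_image_sub_le_of_norm_fderiv_le'
    (f := G) (φ := fderiv ℝ G (γ t)) (C := ε)
    (fun z _ => (hG.differentiable one_ne_zero).differentiableAt) key
    (left_mem_segment ..) (right_mem_segment ..)
  refine h3.trans ?_
  gcongr
  exact (γ' - γ).norm_coe_le_norm t

theorem ContinuousMap.contDiff_postcomp {G : E → F} (hG : ContDiff ℝ 1 G) :
    ContDiff ℝ 1 fun γ : C(K, E) => (⟨G, hG.continuous⟩ : C(E, F)).comp γ := by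
  refine contDiff_one_iff_hasFDerivAt.2
    ⟨_, ?_, fun γ => ContinuousMap.hasFDerivAt_postcomp hG γ⟩
  exact ContinuousMap.applyL.continuous.comp (ContinuousMap.continuous_postcomp _)

end Nemytskii

/-! ### Volterra operators -/

section Volterra

variable {E : Type*} [NormedAddCommGroup E] [NormedSpace ℝ E]

/-- The primitive vanishing at `0` of a continuous function on the unit interval. -/
noncomputable def unitInterval.primitive : C(I, E) →L[ℝ] C(I, E) :=
  LinearMap.mkContinuous
    { toFun := fun h => ⟨fun t => ∫ s in (0 : ℝ)..t, IccExtend zero_le_one h s,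
        (intervalIntegral.continuous_primitive
          (fun a b => (h.continuous.Icc_extend' (h := zero_le_one)).intervalIntegrable a b) 0).comp
          continuous_subtype_val⟩
      map_add' := fun h k => by
        ext t
        exact intervalIntegral.integral_add
          ((h.continuous.Icc_extend' (h := zero_le_one)).intervalIntegrable _ _)
          ((k.continuous.Icc_extend' (h := zero_le_one)).intervalIntegrable _ _)
      map_smul' := fun c h => by
        ext t
        exact intervalIntegral.integral_smul c _ } 1
    (fun h => by
      rw [one_mul]
      refine (ContinuousMap.norm_le _ (by positivity)).2 fun t => ?_
      refine (intervalIntegral.norm_integral_le_of_norm_le_const (C := ‖h‖)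
        fun s _ => h.norm_coe_le_norm _).trans ?_
      rw [sub_zero, abs_of_nonneg t.2.1]
      exact mul_le_of_le_one_right (norm_nonneg _) t.2.2)

theorem unitInterval.primitive_apply (h : C(I, E)) (t : I) :
    unitInterval.primitive h t = ∫ s in (0 : ℝ)..t, IccExtend zero_le_one h s := rfl

/-- Each further integration turns `s ^ n / n!` into `t ^ (n + 1) / (n + 1)!`; the factorial makes
some power a contraction whatever the size of `A`. -/
theorem unitInterval.norm_volterra_pow_apply_le (A : C(I, E →L[ℝ] E)) (n : ℕ) (h : C(I, E))
    (t : I) :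
    ‖((unitInterval.primitive ∘L ContinuousMap.applyL A) ^ n) h t‖ ≤
      ‖A‖ ^ n * (t : ℝ) ^ n / n.factorial * ‖h‖ := by
  induction n generalizing t with
  | zero => simpa using h.norm_coe_le_norm t
  | succ n ih =>
    rw [pow_succ', mul_apply_eq_comp, ContinuousLinearMap.comp_apply,
      unitInterval.primitive_apply]
    have hb : ∀ s ∈ Ioc (0 : ℝ) t, ‖IccExtend zero_le_one (ContinuousMap.applyL A
        (((unitInterval.primitive ∘L ContinuousMap.applyL A) ^ n) h)) s‖ ≤
        ‖A‖ ^ (n + 1) / n.factorial * ‖h‖ * s ^ n := by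
      intro s hs
      have hsI : s ∈ Icc (0 : ℝ) 1 := ⟨hs.1.le, hs.2.trans t.2.2⟩
      rw [IccExtend_of_mem _ _ hsI, ContinuousMap.applyL_apply]
      refine ((A ⟨s, hsI⟩).le_of_opNorm_le_of_le (A.norm_coe_le_norm _) (ih ⟨s, hsI⟩)).trans
        (le_of_eq ?_)
      simp only [pow_succ]
      ring
    refine (intervalIntegral.norm_integral_le_of_norm_le t.2.1 (MeasureTheory.ae_of_all _ hb)
      ((continuous_const.mul (continuous_pow n)).intervalIntegrable _ _)).trans (le_of_eq ?_)
    rw [intervalIntegral.integral_const_mul, integral_pow, Nat.factorial_succ]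
    push_cast
    field_simp
    simp

theorem unitInterval.isUnit_one_sub_volterra [CompleteSpace E] (A : C(I, E →L[ℝ] E)) :
    IsUnit (1 - unitInterval.primitive ∘L ContinuousMap.applyL A : C(I, E) →L[ℝ] C(I, E)) := by
  set V : C(I, E) →L[ℝ] C(I, E) := unitInterval.primitive ∘L ContinuousMap.applyL A with hV
  obtain ⟨n, hn⟩ := ((FloorSemiring.tendsto_pow_div_factorial_atTop ‖A‖).eventually
    (gt_mem_nhds one_pos)).exists
  have hVn : ‖V ^ n‖ < 1 := by
    refine (ContinuousLinearMap.opNorm_le_bound _ (by positivity) fun h => ?_).trans_lt hn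
    refine (ContinuousMap.norm_le _ (by positivity)).2 fun t => ?_
    refine (unitInterval.norm_volterra_pow_apply_le A n h t).trans ?_
    gcongr
    exact mul_le_of_le_one_right (by positivity) (pow_le_one₀ t.2.1 t.2.2)
  have hu : IsUnit (1 - V ^ n) :=
    isUnit_one_sub_of_norm_lt_one (R := C(I, E) →L[ℝ] C(I, E)) hVn
  -- `1 - V ^ n = (1 - V) ∑ V ^ i` with commuting factors, so `1 - V` is itself a unit.
  rw [← mul_neg_geom_sum V n] at hu
  refine ((Commute.isUnit_mul_iff ?_).1 hu).1
  exact ((Commute.one_left _).sub_left (Commute.sum_right _ _ _ fun i _ => Commute.self_pow V i))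

end Volterra

/-! ### Differentiable dependence on the data -/

section Flow

variable {E : Type*} [NormedAddCommGroup E] [NormedSpace ℝ E] [CompleteSpace E]

/-- Solutions on `[0, 1]` of `γ' = c F(γ)`, `γ(0) = x` depend in a `C¹` way on `(x, c)` near
any given solution. -/
theorem ContDiff.exists_contDiffAt_solution {F : E → E} (hF : ContDiff ℝ 1 F)
    {x₀ : E} {c₀ : ℝ} {γ₀ : C(I, E)}
    (h₀ : γ₀ = ContinuousMap.const I x₀ +
      c₀ • unitInterval.primitive ((⟨F, hF.continuous⟩ : C(E, E)).comp γ₀)) :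
    ∃ Γ : E × ℝ → C(I, E), ContDiffAt ℝ 1 Γ (x₀, c₀) ∧
      ∀ᶠ p in 𝓝 (x₀, c₀), Γ p = ContinuousMap.const I p.1 +
        p.2 • unitInterval.primitive ((⟨F, hF.continuous⟩ : C(E, E)).comp (Γ p)) := by
  let cst : E →L[ℝ] C(I, E) := LinearMap.mkContinuous
    { toFun := fun x => ContinuousMap.const I x
      map_add' := fun _ _ => rfl
      map_smul' := fun _ _ => rfl } 1
    (fun x => (ContinuousMap.norm_le _ (by positivity)).2 fun t => by
      rw [one_mul]; exact le_rfl)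
  let N : C(I, E) → C(I, E) := fun γ => (⟨F, hF.continuous⟩ : C(E, E)).comp γ
  have hN : ContDiff ℝ 1 N := ContinuousMap.contDiff_postcomp hF
  let f : (E × ℝ) × C(I, E) → C(I, E) := fun q =>
    q.2 - (cst q.1.1 + q.1.2 • unitInterval.primitive (N q.2))
  have hf : ContDiff ℝ 1 f := by
    have h1 : ContDiff ℝ 1 fun q : (E × ℝ) × C(I, E) => N q.2 := hN.comp contDiff_snd
    fun_prop
  have hfz : f ((x₀, c₀), γ₀) = 0 := sub_eq_zero.2 h₀
  set D : C(I, E →L[ℝ] E) :=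
    (⟨fderiv ℝ F, hF.continuous_fderiv one_ne_zero⟩ : C(E, E →L[ℝ] E)).comp γ₀ with hD
  have hinr : fderiv ℝ f ((x₀, c₀), γ₀) ∘L .inr ℝ (E × ℝ) C(I, E) =
      1 - unitInterval.primitive ∘L ContinuousMap.applyL (c₀ • D) := by
    have h1 : HasFDerivAt (fun γ => f ((x₀, c₀), γ))
        (fderiv ℝ f ((x₀, c₀), γ₀) ∘L .inr ℝ (E × ℝ) C(I, E)) γ₀ :=
      ((hf.differentiable one_ne_zero) ((x₀, c₀), γ₀)).hasFDerivAt.comp γ₀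
        (hasFDerivAt_prodMk_right (x₀, c₀) γ₀)
    have h2 : HasFDerivAt (fun γ => f ((x₀, c₀), γ))
        (.id ℝ C(I, E) - (0 + c₀ • (unitInterval.primitive ∘L ContinuousMap.applyL D))) γ₀ :=
      (hasFDerivAt_id γ₀).sub ((hasFDerivAt_const (cst x₀) γ₀).add
        ((unitInterval.primitive.hasFDerivAt.comp γ₀
          (ContinuousMap.hasFDerivAt_postcomp hF γ₀)).const_smul c₀))
    rw [h1.unique h2]
    ext h t
    simp
  have hinv : (fderiv ℝ f ((x₀, c₀), γ₀) ∘L .inr ℝ (E × ℝ) C(I, E)).IsInvertible := by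
    rw [hinr]
    obtain ⟨U, hU⟩ := unitInterval.isUnit_one_sub_volterra (c₀ • D)
    exact ⟨ContinuousLinearEquiv.unitsEquiv ℝ C(I, E) U, hU⟩
  have hfa : ContDiffAt ℝ 1 f ((x₀, c₀), γ₀) := hf.contDiffAt
  refine ⟨hfa.implicitFunction one_ne_zero hinv,
    hfa.contDiffAt_implicitFunction one_ne_zero hinv, ?_⟩
  filter_upwards [hfa.eventually_apply_implicitFunction one_ne_zero hinv] with p hp
  rw [hfz] at hp
  exact sub_eq_zero.1 hp

end Flow

/-! ### Integral curves and integrals up to the zero level -/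

section LevelCurves

variable {E : Type*} [NormedAddCommGroup E] [NormedSpace ℝ E]

theorem eq_of_hasDerivWithinAt_zero {f : ℝ → E} {S : Set ℝ} (hS : Convex ℝ S)
    (hf : ∀ t ∈ S, HasDerivWithinAt f 0 S t) {a b : ℝ} (ha : a ∈ S) (hb : b ∈ S) :
    f a = f b := by
  have h := hS.norm_image_sub_le_of_norm_hasDerivWithin_le (C := 0) hf (by simp) ha hb
  rw [zero_mul] at h
  exact (sub_eq_zero.1 (norm_le_zero_iff.1 h)).symm

theorem IsIntegralCurveOn.comp_affine {F : E → E} {β : ℝ → E} {S S' : Set ℝ}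
    (hβ : IsIntegralCurveOn β (fun _ => F) S) {a c : ℝ} (hmaps : ∀ r ∈ S', a + c * r ∈ S) :
    IsIntegralCurveOn (fun r => β (a + c * r)) (fun _ y => c • F y) S' := by
  intro r hr
  have h : HasDerivWithinAt (fun r : ℝ => a + c * r) c S' r := by
    simpa using (((hasDerivAt_id r).const_mul c).const_add a).hasDerivWithinAt
  exact (hβ _ (hmaps r hr)).scomp r h hmaps

/-- A curve obtained from a fixed point of the integral equation solves the differential
equation. -/
theorem isIntegralCurveOn_of_eq_primitive [CompleteSpace E] {F : E → E} (hF : Continuous F)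
    {x : E} {c : ℝ} {Γ : C(I, E)} (hΓ : Γ = ContinuousMap.const I x +
      c • unitInterval.primitive ((⟨F, hF⟩ : C(E, E)).comp Γ)) :
    IccExtend zero_le_one Γ 0 = x ∧
      IsIntegralCurveOn (IccExtend zero_le_one Γ) (fun _ y => c • F y) (Icc 0 1) := by
  have hcont : Continuous (IccExtend (zero_le_one' ℝ) Γ) := Γ.continuous.Icc_extend'
  have happ : ∀ t ∈ Icc (0 : ℝ) 1, IccExtend zero_le_one Γ t =
      x + c • ∫ s in (0 : ℝ)..t, F (IccExtend zero_le_one Γ s) := by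
    intro t ht
    rw [IccExtend_of_mem _ _ ht, DFunLike.congr_fun hΓ ⟨t, ht⟩]
    rfl
  refine ⟨by simpa using happ 0 (by simp), fun t ht => ?_⟩
  have hd : HasDerivAt (fun t => x + c • ∫ s in (0 : ℝ)..t, F (IccExtend zero_le_one Γ s))
      (c • F (IccExtend zero_le_one Γ t)) t :=
    (((hF.comp hcont).integral_hasStrictDerivAt 0 t).hasDerivAt.const_smul c).const_add x
  exact hd.hasDerivWithinAt.congr_of_mem happ ht

theorem eq_primitive_of_isIntegralCurveOn [CompleteSpace E] {F : E → E} (hF : Continuous F)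
    {c : ℝ} {γ : ℝ → E} (hγc : Continuous γ)
    (hγ : IsIntegralCurveOn γ (fun _ y => c • F y) (Icc 0 1)) :
    (⟨fun t => γ t, hγc.comp continuous_subtype_val⟩ : C(I, E)) =
      ContinuousMap.const I (γ 0) + c • unitInterval.primitive ((⟨F, hF⟩ : C(E, E)).comp
        ⟨fun t => γ t, hγc.comp continuous_subtype_val⟩) := by
  ext t
  have hint : ∫ s in (0 : ℝ)..t, c • F (γ s) = γ t - γ 0 := by
    refine intervalIntegral.integral_eq_sub_of_hasDerivAt_of_le t.2.1 hγc.continuousOn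
      (fun s hs => ?_) ((hF.comp hγc).const_smul c |>.intervalIntegrable _ _)
    have hs' : s ∈ Ioo (0 : ℝ) 1 := ⟨hs.1, hs.2.trans_le t.2.2⟩
    exact (hγ s (Ioo_subset_Icc_self hs')).hasDerivAt (Icc_mem_nhds hs'.1 hs'.2)
  rw [intervalIntegral.integral_smul] at hint
  have hcongr : ∫ s in (0 : ℝ)..t, IccExtend zero_le_one ((⟨F, hF⟩ : C(E, E)).comp
      (⟨fun t => γ t, hγc.comp continuous_subtype_val⟩ : C(I, E))) s =
      ∫ s in (0 : ℝ)..t, F (γ s) := by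
    refine intervalIntegral.integral_congr fun s hs => ?_
    rw [uIcc_of_le t.2.1] at hs
    exact IccExtend_of_mem _ _ ⟨hs.1, hs.2.trans t.2.2⟩
  simp only [ContinuousMap.add_apply, ContinuousMap.smul_apply, unitInterval.primitive_apply,
    hcongr, hint]
  simp

theorem apply_integralCurve_eq_add {F : E → E} {u : E → ℝ} (hu : Differentiable ℝ u)
    (huF : ∀ y, fderiv ℝ u y (F y) = 1) {β : ℝ → E} {S : Set ℝ} (hS : Convex ℝ S)
    (hβ : IsIntegralCurveOn β (fun _ => F) S) {s : ℝ} (h0 : 0 ∈ S) (hs : s ∈ S) :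
    u (β s) = u (β 0) + s := by
  have h := eq_of_hasDerivWithinAt_zero (f := fun t => u (β t) - t) hS (fun t ht => ?_) hs h0
  · simp only [sub_zero] at h
    linarith
  · have := ((hu (β t)).hasFDerivAt.comp_hasDerivWithinAt t (hβ t ht)).sub
      (hasDerivWithinAt_id t S)
    rwa [huF, sub_self] at this

variable [ProperSpace E]

theorem ContDiff.exists_lipschitzOnWith_closedBall {F : E → E} (hF : ContDiff ℝ 1 F) (x : E)
    (R : ℝ) : ∃ K, LipschitzOnWith K F (Metric.closedBall x R) :=
  hF.locallyLipschitz.locallyLipschitzOn.exists_lipschitzOnWith_of_compact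
    (isCompact_closedBall x R)

/-- A bounded `C¹` vector field has integral curves on arbitrarily long time intervals. -/
theorem ContDiff.exists_isIntegralCurveOn_of_bounded {F : E → E}
    (hF : ContDiff ℝ 1 F) {C : ℝ} (hC : ∀ y, ‖F y‖ ≤ C) (x : E) {T : ℝ} (hT : 0 ≤ T) :
    ∃ β : ℝ → E, Continuous β ∧ IsCompact (range β) ∧ β 0 = x ∧
      IsIntegralCurveOn β (fun _ => F) (Icc (-T) T) := by
  have hC0 : 0 ≤ C := (norm_nonneg _).trans (hC x)
  lift C to NNReal using hC0
  lift T to NNReal using hT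
  have hTT : -(T : ℝ) ≤ T := neg_le_self T.2
  -- With speed at most `C`, a curve cannot leave the ball of radius `C * T` within time `T`, so a
  -- Lipschitz constant on that ball suffices.
  obtain ⟨K, hK⟩ := hF.exists_lipschitzOnWith_closedBall x (C * T : NNReal)
  have hpl : IsPicardLindelof (fun _ => F) (⟨0, by simp, by simp⟩ : Icc (-(T : ℝ)) T) x (C * T) 0
      C K :=
    { lipschitzOnWith := fun _ _ => hK
      continuousOn := fun _ _ => continuousOn_const
      norm_le := fun _ _ y _ => hC y
      mul_max_le := by simp }
  obtain ⟨α, hα0, hα⟩ := hpl.exists_eq_forall_mem_Icc_hasDerivWithinAt₀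
  have hαc : Continuous ((Icc (-(T : ℝ)) T).domRestrict α) :=
    continuousOn_iff_continuous_domRestrict.1 fun t ht => (hα t ht).continuousWithinAt
  have heq : ∀ t ∈ Icc (-(T : ℝ)) T, IccExtend hTT ((Icc (-(T : ℝ)) T).domRestrict α) t = α t :=
    fun t ht => IccExtend_of_mem _ _ ht
  -- Freezing the curve outside `[-T, T]` keeps it continuous with compact range.
  refine ⟨IccExtend hTT ((Icc (-(T : ℝ)) T).domRestrict α), hαc.Icc_extend', ?_, ?_, ?_⟩
  · rw [IccExtend_range]
    exact isCompact_range hαc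
  · rw [heq 0 (by simp), ← hα0]
  · intro t ht
    rw [heq t ht]
    exact (hα t ht).congr_of_mem heq ht

theorem ContDiff.eqOn_of_isIntegralCurveOn_Icc {F : E → E} (hF : ContDiff ℝ 1 F)
    {γ δ : ℝ → E} (hγ : IsIntegralCurveOn γ (fun _ => F) (Icc 0 1))
    (hδ : IsIntegralCurveOn δ (fun _ => F) (Icc 0 1)) (h0 : γ 0 = δ 0) :
    EqOn γ δ (Icc 0 1) := by
  obtain ⟨R, hR⟩ := ((isCompact_Icc.image_of_continuousOn hγ.continuousOn).union
    (isCompact_Icc.image_of_continuousOn hδ.continuousOn)).isBounded.subset_closedBall (γ 0)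
  obtain ⟨K, hK⟩ := hF.exists_lipschitzOnWith_closedBall (γ 0) R
  have hd : ∀ {α : ℝ → E}, IsIntegralCurveOn α (fun _ => F) (Icc 0 1) →
      ∀ t ∈ Ico (0 : ℝ) 1, HasDerivWithinAt α (F (α t)) (Ici t) t := by
    intro α hα t ht
    refine (hα t (Ico_subset_Icc_self ht)).mono_of_mem_nhdsWithin ?_
    exact mem_of_superset (Icc_mem_nhdsGE ht.2) (Icc_subset_Icc_left ht.1)
  exact ODE_solution_unique_of_mem_Icc_right (v := fun _ => F)
    (s := fun _ => Metric.closedBall (γ 0) R) (fun _ _ => hK) hγ.continuousOn (hd hγ)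
    (fun t ht => hR (Or.inl (mem_image_of_mem _ (Ico_subset_Icc_self ht)))) hδ.continuousOn (hd hδ)
    (fun t ht => hR (Or.inr (mem_image_of_mem _ (Ico_subset_Icc_self ht)))) h0

/-- Integrals of `g` along the integral curves of `F` up to the zero level set of `u`, where
`F` is normalized so that `u` grows at unit speed along these curves. -/
theorem exists_levelIntegral {F : E → E} (hF : ContDiff ℝ 1 F) {C : ℝ}
    (hC : ∀ y, ‖F y‖ ≤ C) {u : E → ℝ} (hu : ContDiff ℝ 1 u)
    (huF : ∀ y, fderiv ℝ u y (F y) = 1) {g : E → ℝ} (hg : ContDiff ℝ 1 g) :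
    ∃ A : E → ℝ, ContDiff ℝ 1 A ∧ (∀ x, fderiv ℝ A x (F x) = -g x) ∧
      ∀ x, ∃ β : ℝ → E, Continuous β ∧ IsCompact (range β) ∧ β 0 = x ∧
        IsIntegralCurveOn β (fun _ => F) (Icc (-(|u x| + 1)) (|u x| + 1)) ∧
        A x = ∫ s in (0 : ℝ)..(-u x), g (β s) := by
  -- The extra `1` leaves room around both `0` and `-u x` for two-sided derivatives.
  choose β hβc hβK hβ0 hβ using fun x =>
    hF.exists_isIntegralCurveOn_of_bounded hC x (T := |u x| + 1) (by positivity)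
  have hmaps : ∀ x, ∀ r ∈ Icc (0 : ℝ) 1, 0 + -u x * r ∈ Icc (-(|u x| + 1)) (|u x| + 1) := by
    intro x r hr
    rw [mem_Icc, ← abs_le, zero_add, abs_mul, abs_neg, abs_of_nonneg hr.1]
    nlinarith [abs_nonneg (u x), hr.2]
  let A : E → ℝ := fun x => ∫ s in (0 : ℝ)..(-u x), g (β x s)
  -- The chosen `β x` has no regularity in `x`. By uniqueness any rescaled solution computes `A x`,
  -- in particular the `C¹` family from the implicit function theorem.
  have hA : ∀ x (γ : ℝ → E), γ 0 = x →
      IsIntegralCurveOn γ (fun _ y => (-u x) • F y) (Icc 0 1) →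
      A x = -u x * ∫ r in (0 : ℝ)..1, g (γ r) := by
    intro x γ hγ0 hγ
    have heq := (hF.const_smul (-u x)).eqOn_of_isIntegralCurveOn_Icc hγ
      ((hβ x).comp_affine (hmaps x)) (by simp [hγ0, hβ0])
    have h1 : ∫ r in (0 : ℝ)..1, g (γ r) = ∫ r in (0 : ℝ)..1, g (β x (-u x * r)) := by
      refine intervalIntegral.integral_congr fun r hr => ?_
      rw [uIcc_of_le zero_le_one] at hr
      simp only [heq hr, zero_add]
    rw [h1, intervalIntegral.mul_integral_comp_mul_left (f := fun s => g (β x s))]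
    simp [A]
  have hAC : ContDiff ℝ 1 A := by
    rw [contDiff_iff_contDiffAt]
    intro x₀
    have hc0 : Continuous fun r : ℝ => β x₀ (0 + -u x₀ * r) := (hβc x₀).comp (by fun_prop)
    have h₀ := eq_primitive_of_isIntegralCurveOn hF.continuous hc0
      ((hβ x₀).comp_affine (hmaps x₀))
    simp only [mul_zero, add_zero, hβ0] at h₀
    obtain ⟨Γ, hΓ, hΓeq⟩ := hF.exists_contDiffAt_solution h₀
    let ev : C(I, ℝ) →L[ℝ] ℝ := ContinuousMap.evalCLM ℝ 1 ∘L unitInterval.primitive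
    have hp : ContDiff ℝ 1 fun x => (x, -u x) := contDiff_id.prodMk hu.neg
    have hmain : ContDiffAt ℝ 1 (fun x => -u x *
        ev ((⟨g, hg.continuous⟩ : C(E, ℝ)).comp (Γ (x, -u x)))) x₀ := by
      refine hu.neg.contDiffAt.mul (ev.contDiff.contDiffAt.comp x₀ ?_)
      exact (ContinuousMap.contDiff_postcomp (K := I) hg).contDiffAt.comp x₀
        (hΓ.comp x₀ hp.contDiffAt)
    refine hmain.congr_of_eventuallyEq ?_
    filter_upwards [hp.continuous.continuousAt.eventually hΓeq] with x hx
    obtain ⟨h1, h2⟩ := isIntegralCurveOn_of_eq_primitive hF.continuous hx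
    exact hA x _ h1 h2
  refine ⟨A, hAC, fun x => ?_, fun x => ⟨β x, hβc x, hβK x, hβ0 x, hβ x, rfl⟩⟩
  have hT : 0 < |u x| + 1 := by positivity
  have h0mem : (0 : ℝ) ∈ Icc (-(|u x| + 1)) (|u x| + 1) := ⟨by linarith, hT.le⟩
  -- Near `s = 0`, `A (β x s)` is the integral of `g` from `s` to the fixed end `-u x`;
  -- differentiating both expressions at `0` gives `-g x`.
  have hd1 : HasDerivAt (fun s => A (β x s)) (fderiv ℝ A x (F x)) 0 := by
    have h := ((hβ x) 0 h0mem).hasDerivAt (Icc_mem_nhds (by linarith) hT)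
    rw [hβ0] at h
    exact HasFDerivAt.comp_hasDerivAt_of_eq 0 (hAC.differentiable one_ne_zero x).hasFDerivAt h
      (hβ0 x).symm
  have hd2 : HasDerivAt (fun s => ∫ r in s..(-u x), g (β x r)) (-g x) 0 := by
    have hc := hg.continuous.comp (hβc x)
    have := intervalIntegral.integral_hasDerivAt_left (hc.intervalIntegrable 0 (-u x))
      (hc.stronglyMeasurableAtFilter _ _) hc.continuousAt
    simpa [hβ0] using this
  refine hd1.unique (hd2.congr_of_eventuallyEq ?_)
  filter_upwards [Icc_mem_nhds (show -(1 : ℝ) < 0 by norm_num) one_pos] with s hs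
  have hsmem : s ∈ Icc (-(|u x| + 1)) (|u x| + 1) :=
    ⟨by linarith [hs.1, abs_nonneg (u x)], by linarith [hs.2, abs_nonneg (u x)]⟩
  have husv : u (β x s) = u x + s := by
    rw [apply_integralCurve_eq_add (hu.differentiable one_ne_zero) huF (convex_Icc _ _) (hβ x)
      h0mem hsmem, hβ0]
  have hend : -u x ∈ Icc (-(|u x| + 1)) (|u x| + 1) :=
    ⟨by linarith [le_abs_self (u x)], by linarith [neg_le_abs (u x)]⟩
  have hmaps' : ∀ r ∈ Icc (0 : ℝ) 1,
      s + -u (β x s) * r ∈ Icc (-(|u x| + 1)) (|u x| + 1) := by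
    intro r hr
    rw [husv]
    have := (convex_Icc (-(|u x| + 1)) (|u x| + 1)) hsmem hend (sub_nonneg.2 hr.2) hr.1
      (sub_add_cancel _ _)
    convert this using 1
    simp only [smul_eq_mul]
    ring
  rw [hA (β x s) _ (by simp) ((hβ x).comp_affine hmaps')]
  rcases eq_or_ne (u (β x s)) 0 with h0 | h0
  · have : -u x = s := by linarith
    rw [h0, this]
    simp
  · rw [intervalIntegral.mul_integral_comp_add_mul (f := fun s => g (β x s))]
    rw [husv]
    congr 1 <;> ring

end LevelCurves

end

section

open Set Filter Topology

/-! ### Change of time along trajectories -/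

section TimeChange

variable {E : Type*} [NormedAddCommGroup E] [NormedSpace ℝ E]

/-- Since `dβ = p G ds`, the new time `θ` with `dθ = p ds` turns the equation into `dβ = G dθ`. -/
theorem exists_isIntegralCurveOn_timeChange {G : E → E} {p : E → ℝ} (hp : Continuous p)
    (hp0 : ∀ y, 0 < p y) {β : ℝ → E} (hβc : Continuous β) (hβK : IsCompact (range β)) {T : ℝ}
    (hβ : IsIntegralCurveOn β (fun _ y => p y • G y) (Icc (-T) T)) {a : ℝ}
    (ha : a ∈ Ioo (-T) T) :
    ∃ γ : ℝ → E, γ 0 = β 0 ∧ γ (∫ s in (0 : ℝ)..a, p (β s)) = β a ∧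
      IsIntegralCurveOn γ (fun _ => G) (uIcc 0 (∫ s in (0 : ℝ)..a, p (β s))) := by
  let θ : ℝ → ℝ := fun s => ∫ r in (0 : ℝ)..s, p (β r)
  have hθ0 : θ 0 = 0 := intervalIntegral.integral_same
  have hθd : ∀ s, HasDerivAt θ (p (β s)) s := fun s =>
    ((hp.comp hβc).integral_hasStrictDerivAt 0 s).hasDerivAt
  -- Compactness of the range bounds `p ∘ β` below, so `θ` grows at least linearly and is onto `ℝ`.
  obtain ⟨m, hm0, hm⟩ : ∃ m > 0, ∀ s, m ≤ p (β s) := by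
    obtain ⟨y, -, hy⟩ := hβK.exists_isMinOn (range_nonempty β) hp.continuousOn
    exact ⟨p y, hp0 y, fun s => hy (mem_range_self s)⟩
  have hθm : StrictMono θ := strictMono_of_hasDerivAt_pos hθd fun s => hp0 _
  have hmono : Monotone fun s => θ s - m * s := by
    refine monotone_of_hasDerivAt_nonneg
      (fun s => (hθd s).sub ((hasDerivAt_id s).const_mul m)) fun s => ?_
    simpa using hm s
  have hθs : Function.Surjective θ := by
    refine Continuous.surjective
      (continuous_iff_continuousAt.2 fun s => (hθd s).continuousAt) ?_ ?_
    · refine tendsto_atTop_mono' atTop ?_ (tendsto_id.const_mul_atTop hm0)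
      filter_upwards [eventually_ge_atTop 0] with s hs
      simpa [hθ0] using hmono hs
    · refine tendsto_atBot_mono' atBot ?_ (tendsto_id.const_mul_atBot hm0)
      filter_upwards [eventually_le_atBot 0] with s hs
      simpa [hθ0] using hmono hs
  let e : ℝ ≃o ℝ := hθm.orderIsoOfSurjective θ hθs
  have heθ : ∀ s, e.symm (θ s) = s := e.symm_apply_apply
  have hθe : ∀ t, θ (e.symm t) = t := e.apply_symm_apply
  have he0 : e.symm 0 = 0 := by rw [← hθ0, heθ, hθ0]
  refine ⟨fun t => β (e.symm t), congrArg β he0, congrArg β (heθ a), fun t ht => ?_⟩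
  have hd : HasDerivAt e.symm (p (β (e.symm t)))⁻¹ t :=
    (hθd _).of_local_left_inverse e.symm.continuous.continuousAt (hp0 _).ne'
      (Eventually.of_forall hθe)
  have hmem : e.symm t ∈ Ioo (-T) T := by
    have h1 : e.symm t ∈ uIcc 0 a := by
      have := e.symm.monotone.mapsTo_uIcc ht
      rwa [he0, show e.symm (∫ s in (0 : ℝ)..a, p (β s)) = a from heθ a] at this
    have hT : 0 < T := by linarith [ha.1, ha.2]
    exact (ordConnected_Ioo.uIcc_subset (by simp [hT]) ha) h1
  have hβd := (hβ _ (Ioo_subset_Icc_self hmem)).hasDerivAt (Icc_mem_nhds hmem.1 hmem.2)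
  have h := hβd.scomp t hd
  rw [inv_smul_smul₀ (hp0 _).ne'] at h
  exact h.hasDerivWithinAt

theorem sub_eq_integral_of_isIntegralCurveOn {G : E → E} {A g : E → ℝ} (hA : Differentiable ℝ A)
    (hg : Continuous g) (hAG : ∀ x, fderiv ℝ A x (G x) = -g x) {γ : ℝ → E} {T : ℝ}
    (hγ : IsIntegralCurveOn γ (fun _ => G) (uIcc 0 T)) :
    A (γ 0) - A (γ T) = ∫ s in (0 : ℝ)..T, g (γ s) := by
  have hd : ∀ t ∈ uIcc 0 T, HasDerivWithinAt (fun s => -A (γ s)) (g (γ t)) (uIcc 0 T) t := by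
    intro t ht
    have := ((hA (γ t)).hasFDerivAt.comp_hasDerivWithinAt t (hγ t ht)).neg
    rwa [hAG, neg_neg] at this
  rw [intervalIntegral.integral_eq_sub_of_hasDeriv_right (f := fun s => -A (γ s))
    (f' := fun s => g (γ s))
    (fun t ht => (hd t ht).continuousWithinAt) (fun t ht => ?_)
    (hg.comp_continuousOn hγ.continuousOn).intervalIntegrable]
  · ring
  · exact ((hd t (Ioo_subset_Icc_self ht)).hasDerivAt
      (Icc_mem_nhds ht.1 ht.2)).hasDerivWithinAt

end TimeChange

/-! ### Gradient, Laplacian and divergence; stream functions -/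

section Gradient

variable {E : Type*} [NormedAddCommGroup E] [InnerProductSpace ℝ E] [CompleteSpace E]

theorem inner_gradient_eq_fderiv (u : E → ℝ) (x y : E) :
    inner ℝ (gradient u x) y = fderiv ℝ u x y := by
  rw [← toDual_gradient, InnerProductSpace.toDual_apply_apply]

theorem ContDiff.gradient_of_add_one {u : E → ℝ} {n m : WithTop ℕ∞} (hu : ContDiff ℝ n u)
    (hmn : m + 1 ≤ n) : ContDiff ℝ m (gradient u) :=
  (InnerProductSpace.toDual ℝ E).symm.contDiff.comp (hu.fderiv_right hmn)

end Gradient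

namespace Plane

theorem gradient_apply (u : Plane → ℝ) (x : Plane) (i : Fin 2) :
    gradient u x i = fderiv ℝ u x (e i) := by
  rw [← inner_gradient_eq_fderiv, e, EuclideanSpace.inner_single_right]
  simp

theorem eq_sum_smul_e (y : Plane) : y = ∑ i, y i • e i := by
  ext j
  fin_cases j <;> simp [e]

theorem laplacian_eq_sum (u : Plane → ℝ) (x : Plane) :
    Laplacian.laplacian u x = ∑ i, fderiv ℝ (fderiv ℝ u) x (e i) (e i) := by
  rw [congrFun (InnerProductSpace.laplacian_eq_iteratedFDeriv_orthonormalBasis u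
    (EuclideanSpace.basisFun (Fin 2) ℝ)) x]
  simp [iteratedFDeriv_two_apply, e]

theorem contDiff_laplacian {u : Plane → ℝ} (hu : ContDiff ℝ 3 u) :
    ContDiff ℝ 1 (Laplacian.laplacian u : Plane → ℝ) := by
  have h : ContDiff ℝ 1 (fderiv ℝ (fderiv ℝ u)) :=
    (hu.fderiv_right (m := 2) (by norm_num)).fderiv_right (by norm_num)
  rw [show (Laplacian.laplacian u : Plane → ℝ) = fun x => ∑ i, fderiv ℝ (fderiv ℝ u) x (e i) (e i)
    from funext (laplacian_eq_sum u)]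
  fun_prop

theorem divergence_smul_gradient {u σ : Plane → ℝ} (hu : ContDiff ℝ 2 u)
    (hσ : Differentiable ℝ σ) (x : Plane) :
    divergence (fun y => σ y • gradient u y) x =
      fderiv ℝ σ x (gradient u x) + σ x * Laplacian.laplacian u x := by
  have hd : Differentiable ℝ (fderiv ℝ u) :=
    (hu.fderiv_right (m := 1) (by norm_num)).differentiable one_ne_zero
  have h : ∀ i, fderiv ℝ (fun y => (σ y • gradient u y) i) x (e i) =
      gradient u x i * fderiv ℝ σ x (e i) + σ x * fderiv ℝ (fderiv ℝ u) x (e i) (e i) := by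
    intro i
    have h1 : HasFDerivAt (fun y => fderiv ℝ u y (e i))
        ((fderiv ℝ (fderiv ℝ u) x).flip (e i)) x :=
      ((ContinuousLinearMap.apply ℝ ℝ (e i)).hasFDerivAt.comp x (hd x).hasFDerivAt)
    have h2 : HasFDerivAt (fun y => σ y * fderiv ℝ u y (e i)) _ x := (hσ x).hasFDerivAt.mul h1
    simp only [PiLp.smul_apply, smul_eq_mul, gradient_apply]
    rw [h2.fderiv]
    simp
    ring
  simp only [divergence, h]
  rw [Finset.sum_add_distrib, laplacian_eq_sum, Finset.mul_sum]
  congr 1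
  conv_rhs => rw [eq_sum_smul_e (gradient u x)]
  simp

/-- A `C¹` planar field with zero divergence has a stream function. -/
theorem exists_perpGradient_eq {S : Plane → Plane} (hS : ContDiff ℝ 1 S)
    (hdiv : ∀ x, divergence S x = 0) :
    ∃ v : Plane → ℝ, ContDiff ℝ 1 v ∧ ∀ x, S x = perpGradient v x := by
  let π (i : Fin 2) : Plane →L[ℝ] ℝ := EuclideanSpace.proj i
  have hSi : ∀ i, ContDiff ℝ 1 fun y => S y i := fun i => (π i).contDiff.comp hS
  -- Closedness of this form, the intended `dv`, is exactly `div S = 0`.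
  let ω : Plane → Plane →L[ℝ] ℝ := fun x => S x 1 • π 0 - S x 0 • π 1
  have hω : ContDiff ℝ 1 ω := ((hSi 1).smul contDiff_const).sub ((hSi 0).smul contDiff_const)
  have hdω : ∀ a x y, fderiv ℝ ω a x y = fderiv ℝ (fun y => S y 1) a x * y 0 -
      fderiv ℝ (fun y => S y 0) a x * y 1 := by
    intro a x y
    have h : HasFDerivAt ω _ a :=
      (((hSi 1).differentiable one_ne_zero a).hasFDerivAt.smul_const (π 0)).sub
        (((hSi 0).differentiable one_ne_zero a).hasFDerivAt.smul_const (π 1))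
    rw [h.fderiv]
    simp [π]
  obtain ⟨v, hv⟩ := convex_univ.exists_forall_hasFDerivAt_of_fderiv_symmetric (s := univ)
    (ω := ω) isOpen_univ
    (hω.differentiable one_ne_zero).differentiableOn (by
      intro a _ x y
      rw [hdω, hdω]
      have h := hdiv a
      simp only [divergence, Fin.sum_univ_two] at h
      have hx := fun i => congrArg (fderiv ℝ (fun y => S y i) a) (eq_sum_smul_e x)
      have hy := fun i => congrArg (fderiv ℝ (fun y => S y i) a) (eq_sum_smul_e y)
      simp only [Fin.sum_univ_two, map_add, map_smul, smul_eq_mul] at hx hy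
      rw [hx, hx, hy, hy]
      linear_combination (x 1 * y 0 - x 0 * y 1) * h)
  refine ⟨v, contDiff_one_iff_hasFDerivAt.2 ⟨ω, hω.continuous, fun x => hv x (mem_univ x)⟩,
    fun x => ?_⟩
  ext i
  fin_cases i <;> simp [perpGradient, (hv x (mem_univ x)).fderiv, ω, π, e]

end Plane

/-! ### Crossing time, conductivity and rectification -/

namespace Plane

theorem exists_crossingTime {u : Plane → ℝ} (hu : ContDiff ℝ 3 u)
    (hinf : 0 < ⨅ x : Plane, ‖gradient u x‖) :
    ∃ τ ρ : Plane → ℝ, ContDiff ℝ 1 τ ∧ ContDiff ℝ 1 ρ ∧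
      (∀ x, fderiv ℝ τ x (gradient u x) = -1) ∧
      (∀ x, fderiv ℝ ρ x (gradient u x) = -Laplacian.laplacian u x) ∧
      (∀ x, u x = 0 → τ x = 0) ∧ (∀ x, u x = 0 → ρ x = 0) ∧
      ∀ x, ReachesZeroLevelAt u x (τ x) := by
  set c := ⨅ x : Plane, ‖gradient u x‖ with hc
  have hcle : ∀ x, c ≤ ‖gradient u x‖ := fun x =>
    ciInf_le ⟨0, forall_mem_range.2 fun _ => norm_nonneg _⟩ x
  have hpos : ∀ x, 0 < ‖gradient u x‖ := fun x => hinf.trans_le (hcle x)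
  have hG : ContDiff ℝ 1 (gradient u) := hu.gradient_of_add_one (by norm_num)
  let p : Plane → ℝ := fun x => (‖gradient u x‖ ^ 2)⁻¹
  have hp : ContDiff ℝ 1 p := (hG.norm_sq ℝ).inv fun x => (pow_pos (hpos x) 2).ne'
  have hp0 : ∀ x, 0 < p x := fun x => inv_pos.2 (pow_pos (hpos x) 2)
  let F : Plane → Plane := fun x => p x • gradient u x
  have hF : ContDiff ℝ 1 F := hp.smul hG
  have hFb : ∀ x, ‖F x‖ ≤ c⁻¹ := by
    intro x
    have : ‖F x‖ = ‖gradient u x‖⁻¹ := by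
      simp only [F, p, norm_smul, norm_inv, norm_pow, norm_norm]
      field_simp [(hpos x).ne']
    rw [this]
    exact inv_anti₀ hinf (hcle x)
  have hu1 : ContDiff ℝ 1 u := hu.of_le (by norm_num)
  have huF : ∀ x, fderiv ℝ u x (F x) = 1 := by
    intro x
    rw [← inner_gradient_eq_fderiv, real_inner_smul_right, real_inner_self_eq_norm_sq]
    exact inv_mul_cancel₀ (pow_pos (hpos x) 2).ne'
  have hcancel : ∀ (A : Plane → ℝ) (k : ℝ) (x : Plane), fderiv ℝ A x (F x) = -(p x * k) →
      fderiv ℝ A x (gradient u x) = -k := by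
    intro A k x h
    rw [map_smul, smul_eq_mul, ← mul_neg] at h
    exact mul_left_cancel₀ (hp0 x).ne' h
  obtain ⟨τ, hτ, hτF, hτβ⟩ := exists_levelIntegral hF hFb hu1 huF hp
  obtain ⟨ρ, hρ, hρF, hρβ⟩ := exists_levelIntegral hF hFb hu1 huF (hp.mul (contDiff_laplacian hu))
  refine ⟨τ, ρ, hτ, hρ, fun x => hcancel τ 1 x (by rw [hτF, mul_one]),
    fun x => hcancel ρ _ x (hρF x), fun x hx => ?_, fun x hx => ?_, fun x => ?_⟩
  · obtain ⟨β, -, -, -, -, h⟩ := hτβ x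
    simpa [hx] using h
  · obtain ⟨β, -, -, -, -, h⟩ := hρβ x
    simpa [hx] using h
  · obtain ⟨β, hβc, hβK, hβ0, hβ, hτx⟩ := hτβ x
    have hmem : -u x ∈ Ioo (-(|u x| + 1)) (|u x| + 1) :=
      ⟨by linarith [le_abs_self (u x)], by linarith [neg_le_abs (u x)]⟩
    obtain ⟨γ, hγ0, hγT, hγ⟩ := exists_isIntegralCurveOn_timeChange (G := gradient u)
      hp.continuous hp0 hβc hβK hβ hmem
    rw [← hτx] at hγT hγ
    refine ⟨γ, ⟨hγ0.trans hβ0, hγ⟩, ?_⟩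
    rw [hγT, apply_integralCurve_eq_add (hu1.differentiable one_ne_zero) huF (convex_Icc _ _) hβ
      ⟨by linarith [abs_nonneg (u x)], by positivity⟩ (Ioo_subset_Icc_self hmem), hβ0]
    ring

theorem jacobian_mulVec (Φ : Plane → Plane) (x y : Plane) : (jacobian Φ x).mulVec y.ofLp = (fderiv ℝ Φ x y).ofLp := by
  ext i
  conv_rhs => rw [eq_sum_smul_e y]
  simp [jacobian, Matrix.mulVec, dotProduct, mul_comm]

theorem isUnit_jacobian_of_injective (Φ : Plane → Plane) {x : Plane}
    (hinj : ∀ y, fderiv ℝ Φ x y = 0 → y = 0) :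
    IsUnit (jacobian Φ x) := by
  rw [← Matrix.mulVec_injective_iff_isUnit]
  intro y z hyz
  have h := hinj (WithLp.toLp 2 (y - z)) (by
    ext i
    rw [← congrFun (jacobian_mulVec Φ x _) i]
    simp [Matrix.mulVec_sub, show (jacobian Φ x).mulVec y = (jacobian Φ x).mulVec z from hyz])
  ext i
  have := congrArg (fun w : Plane => w i) h
  simpa [sub_eq_zero] using this

end Plane

end

theorem mainTheorem7 (u : Plane → ℝ) (hu : ContDiff ℝ 3 u)
    (hinf : 0 < ⨅ x : Plane, ‖gradient u x‖) :
    ∃ (Φ : Plane → Plane) (τ σ v : Plane → ℝ),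
      -- `Φ` is `C¹`, its Jacobian is everywhere invertible, and it maps `∇u` to `e₁`
      ContDiff ℝ 1 Φ ∧
      (∀ x, IsUnit (Plane.jacobian Φ x)) ∧
      (∀ x, (Plane.jacobian Φ x).mulVec (gradient u x).ofLp = ![1, 0]) ∧
      -- `Φ` carries solutions of `X' = ∇u(X)`, on any time set, to solutions of `Y' = e₁`
      (∀ (X : ℝ → Plane) (s : Set ℝ), IsIntegralCurveOn X (fun _ y => gradient u y) s →
        IsIntegralCurveOn (fun t => Φ (X t)) (fun _ _ => Plane.e 0) s) ∧
      -- `Φ = (-τ, v)`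
      (∀ x, Φ x = !₂[-τ x, v x]) ∧
      -- `τ x` is the unique time at which the trajectory from `x` reaches `{u = 0}`
      ContDiff ℝ 1 τ ∧
      (∀ x T, Plane.ReachesZeroLevelAt u x T ↔ T = τ x) ∧
      -- `σ` is the conductivity given by the integral of the Laplacian along trajectories
      ContDiff ℝ 1 σ ∧
      (∀ x, 0 < σ x) ∧
      (∀ x γ, Plane.IsGradientTrajectory u x (τ x) γ →
        σ x = Real.exp (∫ s in (0 : ℝ)..τ x, Laplacian.laplacian u (γ s))) ∧
      (∀ x, Plane.divergence (fun y => σ y • gradient u y) x = 0) ∧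
      -- `v` is a stream function of `σ∇u`
      ContDiff ℝ 1 v ∧
      (∀ x, σ x • gradient u x = Plane.perpGradient v x) := by
  obtain ⟨τ, ρ, hτ, hρ, hτG, hρG, hτ0, hρ0, hreach⟩ := Plane.exists_crossingTime hu hinf
  have hG : ContDiff ℝ 1 (gradient u) := hu.gradient_of_add_one (by norm_num)
  -- `τ` decreases at unit speed along every trajectory, which gives uniqueness of the crossing
  -- time.
  have htime : ∀ x T γ, Plane.IsGradientTrajectory u x T γ → τ x - τ (γ T) = T := by
    rintro x T γ ⟨rfl, hγ⟩
    rw [sub_eq_integral_of_isIntegralCurveOn (g := fun _ => 1) (hτ.differentiable one_ne_zero)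
      continuous_const hτG hγ]
    simp
  have hτu : ∀ x T, Plane.ReachesZeroLevelAt u x T ↔ T = τ x := by
    refine fun x T => ⟨?_, fun h => h ▸ hreach x⟩
    rintro ⟨γ, hγ, hγu⟩
    rw [← htime x T γ hγ, hτ0 _ hγu, sub_zero]
  -- At the endpoint `τ` vanishes, so its own crossing takes no time: `u`, hence `ρ`, is zero there.
  have hzero : ∀ x γ, Plane.IsGradientTrajectory u x (τ x) γ → ρ (γ (τ x)) = 0 := by
    intro x γ hγ
    have hτγ : τ (γ (τ x)) = 0 := by linarith [htime x _ γ hγ]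
    obtain ⟨δ, hδ, hδu⟩ := hreach (γ (τ x))
    rw [hτγ, hδ.1] at hδu
    exact hρ0 _ hδu
  have hσ : ContDiff ℝ 1 fun x => Real.exp (ρ x) := hρ.exp
  have hdiv : ∀ x, Plane.divergence (fun y => Real.exp (ρ y) • gradient u y) x = 0 := by
    intro x
    rw [Plane.divergence_smul_gradient (hu.of_le (by norm_num)) (hσ.differentiable one_ne_zero),
      ((hρ.differentiable one_ne_zero x).hasFDerivAt.exp).fderiv]
    simp [hρG]
  obtain ⟨v, hv, hvS⟩ := Plane.exists_perpGradient_eq (hσ.smul hG) hdiv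
  have hΦ : ContDiff ℝ 1 fun x => (!₂[-τ x, v x] : Plane) := by
    rw [contDiff_euclidean]
    intro i
    fin_cases i
    · simpa using hτ.neg
    · simpa using hv
  have hΦd : ∀ x y, fderiv ℝ (fun x => (!₂[-τ x, v x] : Plane)) x y =
      !₂[-fderiv ℝ τ x y, fderiv ℝ v x y] := by
    intro x y
    have hi : ∀ i, fderiv ℝ (fun x => (!₂[-τ x, v x] : Plane)) x y i =
        fderiv ℝ (fun x => (!₂[-τ x, v x] : Plane) i) x y := fun i => by
      have h : HasFDerivAt (fun x => (!₂[-τ x, v x] : Plane) i) _ x :=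
        (EuclideanSpace.proj i : Plane →L[ℝ] ℝ).hasFDerivAt.comp x
          (hΦ.differentiable one_ne_zero x).hasFDerivAt
      rw [h.fderiv]
      rfl
    ext i
    rw [hi]
    fin_cases i
    · simp [fderiv_fun_neg]
    · simp
  have hvy : ∀ x (y : Plane), fderiv ℝ v x y =
      Real.exp (ρ x) * (gradient u x 1 * y 0 - gradient u x 0 * y 1) := by
    intro x y
    have h0 := congrArg (fun w : Plane => w 0) (hvS x)
    have h1 := congrArg (fun w : Plane => w 1) (hvS x)
    simp [Plane.perpGradient] at h0 h1
    conv_lhs => rw [Plane.eq_sum_smul_e y]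
    simp only [Fin.sum_univ_two, map_add, map_smul, smul_eq_mul]
    linear_combination (-y 0) * h1 + y 1 * h0
  have hΦG : ∀ x, fderiv ℝ (fun x => (!₂[-τ x, v x] : Plane)) x (gradient u x) = Plane.e 0 := by
    intro x
    rw [hΦd, hτG, hvy]
    ext i
    fin_cases i
    · simp [Plane.e]
    · simp [Plane.e, mul_comm]
  refine ⟨fun x => !₂[-τ x, v x], τ, fun x => Real.exp (ρ x), v, hΦ, fun x => ?_, fun x => ?_,
    fun X s hX t ht => ?_, fun _ => rfl, hτ, hτu, hσ, fun x => Real.exp_pos _, fun x γ hγ => ?_,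
    hdiv, hv, hvS⟩
  · refine Plane.isUnit_jacobian_of_injective _ fun y hy => ?_
    rw [hΦd] at hy
    have h0 := congrArg (fun w : Plane => w 0) hy
    have h1 := congrArg (fun w : Plane => w 1) hy
    simp [hvy, (Real.exp_pos _).ne'] at h0 h1
    -- `h1` makes `y` parallel to `∇u`, while `h0` says `∇τ·y = 0`; since `∇τ·∇u = -1`, this forces
    -- `y = 0`.
    have h2 := hτG x
    rw [Plane.eq_sum_smul_e y] at h0
    rw [Plane.eq_sum_smul_e (gradient u x)] at h2
    simp only [Fin.sum_univ_two, map_add, map_smul, smul_eq_mul] at h0 h2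
    ext i
    fin_cases i
    · change y 0 = 0
      linear_combination y 0 * h2 - gradient u x 0 * h0 - fderiv ℝ τ x (Plane.e 1) * h1
    · change y 1 = 0
      linear_combination y 1 * h2 - gradient u x 1 * h0 + fderiv ℝ τ x (Plane.e 0) * h1
  · rw [Plane.jacobian_mulVec, hΦG]
    ext i
    fin_cases i <;> simp [Plane.e]
  · have := (hΦ.differentiable one_ne_zero (X t)).hasFDerivAt.comp_hasDerivWithinAt t (hX t ht)
    rwa [hΦG] at this
  · have h := sub_eq_integral_of_isIntegralCurveOn (hρ.differentiable one_ne_zero)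
      (Plane.contDiff_laplacian hu).continuous hρG hγ.2
    rw [hzero x γ hγ, sub_zero, hγ.1] at h
    exact congrArg Real.exp h
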